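/- Let $h\ge 0$ be an integer, let $q=3^{2h+1}$ and $\alpha=3^{h+1}$, and let $\mathbb F_q$ be the finite field with $q$ elements. For $a\in\mathbb F_q$ put $$f_a(x)=x^{2\alpha+3}+(ax)^{\alpha}-a^2x .$$ Then for every nonzero $a\in\mathbb F_q$ the set $$D_a=\{f_a(x^2) : x\in\mathbb F_q,\ x\neq 0\}$$ is a skew Hadamard difference set in the additive group $(\mathbb F_q,+)$. That is, there is an integer $\lambda\ge 0$ such that every nonzero $g\in\mathbb F_q$ can be written as $g=y-z$ with $y,z\in D_a$ in exactly $\lambda$ ways (so $D_a$ is a difference set), and $\mathbb F_q$ is the disjoint union of $D_a$, $-D_a=\{-d : d\in D_a\}$ and $\{0\}$. -/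

import Mathlib

open scoped Pointwise

/-- `D` is a `(v, k, l)` difference set in the finite (additively written) group `G` of order `v`:
it has `k` elements, and the list of differences `x - y` with `x, y ∈ D`, `x ≠ y` represents every
nonzero element of `G` exactly `l` times. -/
structure IsDifferenceSet {G : Type*} [AddGroup G] [Finite G] (D : Set G) (v k l : ℕ) : Prop where
  card_group : Nat.card G = v
  card_set : D.ncard = k
  card_repr : ∀ g : G, g ≠ 0 →
    {p : G × G | p.1 ∈ D ∧ p.2 ∈ D ∧ p.1 ≠ p.2 ∧ p.1 - p.2 = g}.ncard = l

/-- `D` is a skew Hadamard difference set in the finite (additively written) group `G`: it is a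
difference set, and `G` is the disjoint union of `D`, `-D` and `{0}`. -/
structure IsSkewHadamardDifferenceSet {G : Type*} [AddGroup G] [Finite G] (D : Set G) : Prop where
  isDifferenceSet : ∃ v k l : ℕ, IsDifferenceSet D v k l
  disjoint_neg : Disjoint D (-D)
  zero_notMem : (0 : G) ∉ D
  union_eq : D ∪ -D ∪ {0} = Set.univ

/-- The map `f_a(x) = x ^ (2 α + 3) + (a x) ^ α - a ^ 2 x`. -/
def reeTitsMap {F : Type*} [Field F] (α : ℕ) (a x : F) : F :=
  x ^ (2 * α + 3) + (a * x) ^ α - a ^ 2 * x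

/-- The set `D_a = {f_a(x ^ 2) : x ∈ F, x ≠ 0}`. -/
def reeTitsSet {F : Type*} [Field F] (α : ℕ) (a : F) : Set F :=
  {y | ∃ x : F, x ≠ 0 ∧ reeTitsMap α a (x ^ 2) = y}

/-! Write `σ` for `x ↦ x ^ α`. Since `σ ∘ σ` is cubing, `f_a(x) = x³ σ(x)² + σ(a x) - a² x`. This
map is odd and, for `a ≠ 0`, bijective, while `-1` is a nonsquare because `q ≡ 3 mod 4`; hence
`D_a`, the image of the nonzero squares, is skew.

For a skew set `D`, the sums of a nontrivial additive character over `D` and `-D` add up to `-1` and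
differ by `N √-3` with `N` an odd integer, so their product is `(1 + 3 N²) / 4`. By Parseval, `N²`
has mean `3 ^ (2 h)` over the nontrivial characters. If `3 ^ h ∣ N` always, then `N ≠ 0` gives `N² ≥
3 ^ (2 h)`, hence equality everywhere, and Fourier inversion gives every `g ≠ 0` equally many
representations (`four_mul_card_differences`).

The divisibility concerns `∑ η(y) ψ(b f_a(y))` with `η` the quadratic character. Invariance of the
trace under `σ` turns this into a sum with the Welch exponent `α + 2` (`pow_dvd_welch_sum`).
Expanding `ψ` in Gauss sums and applying Stickelberger's lower bound (`pow_weight_dvd_gauss`) leaves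
an inequality between ternary digit sums, `le_ternaryWeight_add`, proved by counting carries. -/

/-! ### Injectivity of `f_a` -/

/-- In the application `B = σ A`, `R = σ r`, `c = r³`, and `hσ` is the image of `h` under `σ`.
Eliminating `c` and `B` leaves `(A - P - P²) A³ = 0` with `P = R + 1`, and `A = P + P²` forces `B =
0`. -/
theorem eq_zero_of_reeTits_factor {F : Type*} [Field F] [CharP F 3] {A B R c : F}
    (hB : B = A ^ 2 - 1 - R ^ 2 + R * c) (hBA : B = 0 → A = 0)
    (h : (R + 1) * (A + (R + c)) + A ^ 2 = 0)
    (hσ : (c + 1) * (B + (c + R ^ 3)) + B ^ 2 = 0) : A = 0 := by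
  obtain ⟨P, rfl⟩ : ∃ P, R = P - 1 := ⟨R + 1, by ring⟩
  obtain ⟨C, rfl⟩ : ∃ C, c = C - 1 := ⟨c + 1, by ring⟩
  by_cases hP : P = 0
  · subst hP
    have : A ^ 2 = 0 := by linear_combination h
    exact pow_eq_zero_iff two_ne_zero |>.1 this
  have hPB : P * B = (A - P) * (A - P - P ^ 2) := by grind
  have hC : P * C = -((A - P) ^ 2 + P) := by grind
  have h2 : C * P * (P - A + P ^ 2) + B ^ 2 = 0 := by grind
  have h3 : (A - P - P ^ 2) * (A ^ 3) = 0 := by grind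
  rcases mul_eq_zero.1 h3 with h4 | h4
  · have hB0 : B = 0 := by
      rw [h4, mul_zero] at hPB
      exact (mul_eq_zero.1 hPB).resolve_left hP
    exact hBA hB0
  · exact pow_eq_zero_iff three_ne_zero |>.1 h4

/-- Substituting `B` into `hσ` gives a quartic in `A`, which in characteristic 3 splits into two
quadratics exchanged by `(R, c) ↦ (-R, -c)`. -/
theorem reeTits_factor {F : Type*} [Field F] [CharP F 3] {A B R c : F}
    (hB : B = A ^ 2 - 1 - R ^ 2 + R * c)
    (hσ : A ^ 3 = B ^ 2 - 1 - c ^ 2 + c * R ^ 3) :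
    ((R + 1) * (A + (R + c)) + A ^ 2) * ((-R + 1) * (A + (-R + -c)) + A ^ 2) = 0 := by
  grind

/-- The `σ`-invariant formulation of the injectivity of `reeTitsMap`, for an endomorphism `σ` that
squares to the Frobenius map. -/
theorem reeTits_no_solution {F : Type*} [Field F] [CharP F 3] (σ : F →+* F)
    (hσ : ∀ x, σ (σ x) = x ^ 3) {A r : F}
    (h : σ A = A ^ 2 - 1 - σ r ^ 2 + σ r * r ^ 3) : A = 0 := by
  have key : ∀ r : F, σ A = A ^ 2 - 1 - σ r ^ 2 + σ r * r ^ 3 →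
      (σ r + 1) * (A + (σ r + r ^ 3)) + A ^ 2 = 0 → A = 0 := fun r h h' => by
    refine eq_zero_of_reeTits_factor h (fun h0 => (map_eq_zero σ).1 h0) h' ?_
    have := congrArg σ h'
    simpa [hσ] using this
  have h2 := congrArg σ h
  simp only [map_sub, map_add, map_mul, map_pow, map_one, hσ] at h2
  have h3 : A ^ 3 = σ A ^ 2 - 1 - (r ^ 3) ^ 2 + r ^ 3 * σ r ^ 3 := by rw [h2]
  rcases mul_eq_zero.1 (reeTits_factor h h3) with h4 | h4
  · exact key r h h4
  -- The equation is invariant under `r ↦ -r`, which swaps the two factors.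
  · refine key (-r) ?_ ?_
    · rw [map_neg, h]; ring
    · rw [map_neg, ← h4]; ring

theorem reeTits_injective_aux {F : Type*} [Field F] [CharP F 3] (σ : F →+* F)
    (hσ : ∀ x, σ (σ x) = x ^ 3) {a : F} (ha : a ≠ 0) :
    Function.Injective (fun x => x ^ 3 * σ x ^ 2 + σ (a * x) - a ^ 2 * x) := by
  intro x y hxy
  by_contra hne
  have hp : x - y ≠ 0 := sub_ne_zero.2 hne
  have hP : σ (x - y) ≠ 0 := (map_ne_zero σ).2 hp
  have h3 : (3 : F) = 0 := by exact_mod_cast CharP.cast_eq_zero F 3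
  obtain ⟨p, hpe⟩ : ∃ p, p = x - y := ⟨_, rfl⟩
  rw [← hpe] at hp hP
  -- As `-2 = 1`, this gives `x = p (r - 1)` and `y = p (r + 1)`. With `a = A p σ(p)`, every term of
  -- `f_a(x) - f_a(y)` is a multiple of `p³ σ(p)²`; dividing by it gives the equation of
  -- `reeTits_no_solution`.
  obtain ⟨r, hr⟩ : ∃ r, p * r = -(x + y) := ⟨-(x + y) / p, by field_simp⟩
  obtain ⟨A, rfl⟩ : ∃ A, a = A * (p * σ p) := ⟨a / (p * σ p), by field_simp⟩
  obtain rfl : x = p * (r - 1) := by linear_combination x * h3 - hr + hpe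
  obtain rfl : y = p * (r + 1) := by linear_combination y * h3 - hr - hpe
  refine left_ne_zero_of_mul ha (reeTits_no_solution σ hσ (r := r) ?_)
  simp only [map_mul, map_add, map_sub, map_one, hσ] at hxy
  refine mul_left_cancel₀ (mul_ne_zero (pow_ne_zero 3 hp) (pow_ne_zero 2 hP)) ?_
  generalize σ p = P at *
  generalize σ r = R at *
  generalize σ A = B at *
  grind

theorem reeTitsMap_eq {F : Type*} [Field F] [CharP F 3] (k : ℕ) (a x : F) :
    reeTitsMap (3 ^ k) a x =
      x ^ 3 * iterateFrobenius F 3 k x ^ 2 + iterateFrobenius F 3 k (a * x) - a ^ 2 * x := by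
  simp only [reeTitsMap, iterateFrobenius_def]
  ring

theorem iterateFrobenius_iterateFrobenius_of_card {F : Type*} [Field F] [Finite F] [CharP F 3]
    {h : ℕ} (hq : Nat.card F = 3 ^ (2 * h + 1)) (x : F) :
    iterateFrobenius F 3 (h + 1) (iterateFrobenius F 3 (h + 1) x) = x ^ 3 := by
  have := Fintype.ofFinite F
  rw [iterateFrobenius_def, iterateFrobenius_def, ← pow_mul, ← pow_add,
    show h + 1 + (h + 1) = (2 * h + 1) + 1 by ring, pow_succ, ← hq, pow_mul,
    Nat.card_eq_fintype_card, FiniteField.pow_card]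

theorem reeTitsMap_injective {F : Type*} [Field F] [Finite F] [CharP F 3] {h : ℕ}
    (hq : Nat.card F = 3 ^ (2 * h + 1)) {a : F} (ha : a ≠ 0) :
    Function.Injective (reeTitsMap (3 ^ (h + 1)) a) := by
  have := reeTits_injective_aux (iterateFrobenius F 3 (h + 1))
    (iterateFrobenius_iterateFrobenius_of_card hq) ha
  intro x y hxy
  simp only [reeTitsMap_eq] at hxy
  exact this hxy

theorem reeTitsMap_neg {F : Type*} [Field F] (k : ℕ) (a x : F) :
    reeTitsMap (3 ^ k) a (-x) = -reeTitsMap (3 ^ k) a x := by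
  have h3 : Odd (3 ^ k) := Odd.pow (by decide)
  have h2 : Odd (2 * 3 ^ k + 3) := by
    rw [show 2 * 3 ^ k + 3 = 2 * (3 ^ k + 1) + 1 by ring]
    exact odd_two_mul_add_one _
  simp only [reeTitsMap, mul_neg, h2.neg_pow, h3.neg_pow]
  ring

/-! ### The coefficient ring: ramified Witt vectors -/

/-- A ring `R` with a prime `ω - 1` over `3`, where `ω` is a primitive cube root of unity, with
residue field `F` and multiplicative representatives of the residue classes. -/
structure CubicTeichmullerRing (F R : Type*) [Field F] [CommRing R] where
  res : R →+* F
  tau : F →* R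
  omega : R
  tau_zero : tau 0 = 0
  res_tau : ∀ x, res (tau x) = x
  omega_rel : omega ^ 2 + omega + 1 = 0
  omega_ne_one : omega ≠ 1
  dvd_of_res_eq_zero : ∀ x, res x = 0 → omega - 1 ∣ x

theorem charZero_of_three_ne_zero {W F : Type*} [CommRing W] [IsDomain W] [Field F] [CharP F 3]
    (φ : W →+* F) (h3 : (3 : W) ≠ 0) : CharZero W := by
  refine charZero_of_inj_zero fun n hn => ?_
  by_contra hn0
  obtain ⟨k, l, hl, rfl⟩ := Nat.exists_eq_pow_mul_and_not_dvd hn0 3 (by norm_num)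
  push_cast at hn
  have hl0 := congrArg φ ((mul_eq_zero.1 hn).resolve_left (pow_ne_zero k h3))
  rw [map_natCast, map_zero, CharP.cast_eq_zero_iff F 3] at hl0
  exact hl hl0

universe u

open Polynomial in
-- Adjoin to the Witt vectors a root `π` of the Eisenstein polynomial `X² + 3 X + 3`. Then `ω = π +
-- 1` satisfies `ω² + ω + 1 = 0`, and Teichmüller lifts give the representatives.
theorem exists_cubicTeichmullerRing (F : Type u) [Field F] [CharP F 3] [PerfectRing F 3] :
    ∃ (R : Type u) (_ : CommRing R) (_ : IsDomain R) (_ : CharZero R),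
      Nonempty (CubicTeichmullerRing F R) := by
  have : Fact (Nat.Prime 3) := ⟨by norm_num⟩
  let W := WittVector 3 F
  let f : W[X] := X ^ 2 + C 3 * X + C 3
  have h3 : Prime (3 : W) := by exact_mod_cast (WittVector.irreducible (p := 3) (k := F)).prime
  have hdeg : f.natDegree = 2 := by simp only [f]; compute_degree!
  have hmon : f.Monic := by simp only [f]; monicity!
  have heis : f.IsEisensteinAt (Ideal.span {(3 : W)}) := by
    refine ⟨?_, ?_, ?_⟩
    · rw [hmon.leadingCoeff, Ideal.mem_span_singleton]
      exact fun h => h3.not_isUnit (isUnit_of_dvd_one h)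
    · intro k hk
      rw [hdeg] at hk
      rw [Ideal.mem_span_singleton]
      interval_cases k <;> simp [f, coeff_X]
    · rw [Ideal.span_singleton_pow, Ideal.mem_span_singleton]
      simp only [f]
      rintro ⟨c, hc⟩
      have h1 : (3 : W) * 1 = 3 * (3 * c) := by simp at hc; linear_combination hc
      exact h3.not_isUnit (isUnit_of_dvd_one ⟨c, mul_left_cancel₀ h3.ne_zero h1⟩)
  have hirr : Irreducible f := by
    refine heis.irreducible ?_ hmon.isPrimitive (by omega)
    rwa [Ideal.span_singleton_prime h3.ne_zero]
  have hprime : Prime f := hirr.prime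
  have : IsDomain (AdjoinRoot f) := AdjoinRoot.isDomain_of_prime hprime
  have hinj : Function.Injective (AdjoinRoot.of f) :=
    AdjoinRoot.of.injective_of_degree_ne_zero (by rw [degree_eq_natDegree hmon.ne_zero, hdeg]; norm_num)
  have : CharZero W := charZero_of_three_ne_zero WittVector.constantCoeff h3.ne_zero
  have hof3 : AdjoinRoot.of f 3 = 3 := map_ofNat _ 3
  have : CharZero (AdjoinRoot f) := charZero_of_injective_ringHom hinj
  have hroot : (AdjoinRoot.root f) ^ 2 + 3 * AdjoinRoot.root f + 3 = 0 := by
    have := AdjoinRoot.eval₂_root f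
    simpa only [f, eval₂_add, eval₂_mul, eval₂_pow, eval₂_X, eval₂_C, hof3] using this
  have h3F : (3 : F) = 0 := by exact_mod_cast CharP.cast_eq_zero F 3
  let res : AdjoinRoot f →+* F := AdjoinRoot.lift WittVector.constantCoeff 0 (by
    have : (WittVector.constantCoeff : W →+* F) 3 = 3 := map_ofNat _ 3
    simp [f, this, h3F])
  refine ⟨AdjoinRoot f, inferInstance, inferInstance, inferInstance, ⟨{
    res := res
    tau := (AdjoinRoot.of f : W →* AdjoinRoot f).comp (WittVector.teichmuller 3)
    omega := AdjoinRoot.root f + 1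
    tau_zero := (congrArg (AdjoinRoot.of f) (WittVector.teichmuller_zero 3)).trans (map_zero _)
    res_tau := fun x => (AdjoinRoot.lift_of _).trans (WittVector.teichmuller_coeff_zero 3 x)
    omega_rel := by linear_combination hroot
    omega_ne_one := fun h => by
      have h0 : AdjoinRoot.root f = 0 := by linear_combination h
      rw [h0] at hroot
      simp at hroot
    dvd_of_res_eq_zero := fun x hx => ?_ }⟩⟩
  rw [add_sub_cancel_right]
  obtain ⟨p, rfl⟩ := AdjoinRoot.mk_surjective x
  have h1 : WittVector.constantCoeff (p.coeff 0) = 0 := by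
    simp only [res, AdjoinRoot.lift_mk] at hx
    rwa [eval₂_at_zero] at hx
  have h2 : (3 : W) ∣ p.coeff 0 := by
    have : p.coeff 0 ∈ RingHom.ker (WittVector.constantCoeff : W →+* F) := h1
    rw [WittVector.ker_constantCoeff, Ideal.mem_span_singleton] at this
    exact_mod_cast this
  rw [← p.divX_mul_X_add, map_add, map_mul, AdjoinRoot.mk_X]
  refine dvd_add (Dvd.intro_left _ rfl) ?_
  obtain ⟨c, hc⟩ := h2
  rw [hc, map_mul, map_mul]
  -- The relation for `π` reads `3 = -π (π + 3)`.
  refine Dvd.dvd.mul_right ⟨-(AdjoinRoot.root f + 3), ?_⟩ _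
  have : AdjoinRoot.mk f (C 3) = 3 := (AdjoinRoot.mk_C _).trans hof3
  rw [this]
  linear_combination hroot

/-! ### Ternary digits and carries -/

theorem Function.Periodic.sum_range_add {M : Type*} [AddCommGroup M] {f : ℕ → M} {m : ℕ}
    (hf : Function.Periodic f m) (t : ℕ) :
    ∑ k ∈ Finset.range m, f (k + t) = ∑ k ∈ Finset.range m, f k := by
  induction t with
  | zero => rfl
  | succ t ih =>
    rw [← ih, ← sub_eq_zero, ← Finset.sum_sub_distrib]
    have := Finset.sum_range_sub (fun k => f (k + t)) m
    simp only [add_right_comm _ 1 t] at this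
    simp only [← add_assoc, this, zero_add]
    rw [add_comm, hf, sub_self]

theorem ZMod.val_natCast_mul {n : ℕ} [NeZero n] (c : ℕ) (y : ZMod n) :
    ((c : ZMod n) * y).val = c * y.val % n := by
  conv_lhs => rw [← ZMod.natCast_zmod_val y, ← Nat.cast_mul, ZMod.val_natCast]

/-- The leading ternary digit of a residue modulo `n = 3 ^ m - 1`. -/
def ternaryDigit {n : ℕ} (y : ZMod n) : ℕ := 3 * y.val / n

/-- The sum of the `m` ternary digits of a residue modulo `n = 3 ^ m - 1`. -/
def ternaryWeight (m : ℕ) {n : ℕ} (y : ZMod n) : ℕ :=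
  ∑ k ∈ Finset.range m, ternaryDigit ((3 : ZMod n) ^ k * y)

theorem ternaryWeight_zero {n : ℕ} (m : ℕ) : ternaryWeight m (0 : ZMod n) = 0 := by
  simp [ternaryWeight, ternaryDigit]

/-- For `n = 3 ^ m - 1`, multiplication by 3 rotates the ternary digits, and all digits of `n / 2`
are 1. -/
theorem three_mul_half {n : ℕ} (hn : 2 * (n / 2) = n) : (3 : ZMod n) * (n / 2 : ℕ) = (n / 2 : ℕ) := by
  have : ((2 * (n / 2) : ℕ) : ZMod n) = 0 := by rw [hn, ZMod.natCast_self]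
  push_cast at this
  linear_combination this

theorem three_pow_mul_half {n : ℕ} (hn : 2 * (n / 2) = n) (k : ℕ) :
    (3 : ZMod n) ^ k * (n / 2 : ℕ) = (n / 2 : ℕ) := by
  induction k with
  | zero => simp
  | succ k ih => rw [pow_succ, mul_assoc, three_mul_half hn, ih]

theorem three_pow_mul_relation {n : ℕ} {α y z : ZMod n} (hn : 2 * (n / 2) = n) (h : α * y + 2 * y + z = (n / 2 : ℕ))
    (k : ℕ) : α * (3 ^ k * y) + 2 * (3 ^ k * y) + 3 ^ k * z = (n / 2 : ℕ) := by
  have := congrArg ((3 : ZMod n) ^ k * ·) h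
  simp only [three_pow_mul_half hn] at this
  linear_combination this

section ternary

variable {n : ℕ} [NeZero n]

theorem mul_ternaryDigit (y : ZMod n) :
    n * ternaryDigit y + (3 * y).val = 3 * y.val := by
  have := ZMod.val_natCast_mul 3 y
  rw [Nat.cast_ofNat] at this
  rw [this, ternaryDigit, Nat.div_add_mod]

theorem ternaryDigit_le_two (y : ZMod n) : ternaryDigit y ≤ 2 := by
  have h1 := y.val_lt
  have : 3 * y.val / n < 3 := Nat.div_lt_of_lt_mul (by linarith)
  exact Nat.lt_succ_iff.1 this

theorem ternaryDigit_add_neg {y : ZMod n} (h3 : IsUnit (3 : ZMod n)) (hy : y ≠ 0) :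
    ternaryDigit y + ternaryDigit (-y) = 2 := by
  have : NeZero y := ⟨hy⟩
  have : NeZero (3 * y) := ⟨fun h => hy (h3.mul_right_eq_zero.1 h)⟩
  have h1 := mul_ternaryDigit y
  have h2 := mul_ternaryDigit (-y)
  rw [mul_neg, ZMod.val_neg_of_ne_zero, ZMod.val_neg_of_ne_zero] at h2
  have h4 := y.val_lt
  have h5 := (3 * y).val_lt
  have hn : 0 < n := NeZero.pos n
  refine Nat.eq_of_mul_eq_mul_left hn ?_
  rw [mul_add]
  omega

theorem ternaryWeight_add_neg {m : ℕ} {y : ZMod n} (h3 : IsUnit (3 : ZMod n)) (hy : y ≠ 0) :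
    ternaryWeight m y + ternaryWeight m (-y) = 2 * m := by
  rw [ternaryWeight, ternaryWeight, ← Finset.sum_add_distrib]
  rw [Finset.sum_congr rfl (g := fun _ => 2), Finset.sum_const, Finset.card_range, smul_eq_mul,
    mul_comm]
  intro k _
  rw [mul_neg]
  exact ternaryDigit_add_neg h3 fun h => hy ((h3.pow k).mul_right_eq_zero.1 h)

/-- The ternary expansion of `y.val / n` is periodic with the digits of `y` as period, so `3 ^ t *
y.val / n` is the number formed by its first `t` digits. -/
theorem ternaryPrefix_succ (y : ZMod n) (t : ℕ) :
    3 ^ (t + 1) * y.val / n = 3 * (3 ^ t * y.val / n) + ternaryDigit ((3 : ZMod n) ^ t * y) := by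
  have := ZMod.val_natCast_mul (3 ^ t) y
  push_cast at this
  rw [ternaryDigit, this, pow_succ', mul_assoc]
  conv_lhs => rw [← Nat.div_add_mod (3 ^ t * y.val) n, mul_add, mul_left_comm]
  rw [Nat.mul_add_div (NeZero.pos n)]

/-- The carry at the place of the leading digit in the addition `α y + 2 y + z = n / 2`. -/
def weightCarry (α y z : ZMod n) : ℤ :=
  (((α * y).val + 2 * y.val + z.val : ℤ) - (n / 2 : ℕ)) / n

variable {α y z : ZMod n}

theorem mul_weightCarry (h : α * y + 2 * y + z = (n / 2 : ℕ)) :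
    n * weightCarry α y z = (α * y).val + 2 * y.val + z.val - (n / 2 : ℕ) := by
  refine Int.mul_ediv_cancel' ?_
  rw [← ZMod.intCast_zmod_eq_zero_iff_dvd]
  rw [Int.cast_sub, Int.cast_natCast, ← h]
  push_cast
  simp only [ZMod.natCast_val, ZMod.cast_id', id_eq, sub_self]

theorem weightCarry_nonneg (hn : 2 * (n / 2) = n) (h : α * y + 2 * y + z = (n / 2 : ℕ)) :
    0 ≤ weightCarry α y z := by
  have h1 := mul_weightCarry h
  have h2 : (0 : ℤ) < n := by exact_mod_cast NeZero.pos n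
  by_contra hc
  have : n * weightCarry α y z ≤ n * (-1) := by gcongr; omega
  omega

/-- One column of the addition with carry; the `-1` comes from `3 (n / 2) = n / 2 + n`. -/
theorem three_mul_weightCarry (hn : 2 * (n / 2) = n) (h : α * y + 2 * y + z = (n / 2 : ℕ)) :
    3 * weightCarry α y z = weightCarry α (3 * y) (3 * z) + ternaryDigit (α * y)
      + 2 * ternaryDigit y + ternaryDigit z - 1 := by
  have h' := three_pow_mul_relation hn h 1
  rw [pow_one] at h'
  have h1 := mul_weightCarry h
  have h2 := mul_weightCarry h'
  have h3 := mul_ternaryDigit (α * y)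
  have h4 := mul_ternaryDigit y
  have h5 := mul_ternaryDigit z
  rw [mul_left_comm] at h2
  have hn0 : (n : ℤ) ≠ 0 := by exact_mod_cast NeZero.ne n
  refine mul_left_cancel₀ hn0 ?_
  zify at h3 h4 h5
  have hn' : 2 * ((n / 2 : ℕ) : ℤ) = n := by exact_mod_cast hn
  linear_combination 3 * h1 - h2 - h3 - 2 * h4 - h5 - hn'

open Classical in
/-- The potential that bounds the local deficit of carries against digits. -/
noncomputable def weightPotential (α y z : ZMod n) : ℤ :=
  if ternaryDigit y = 2 ∨ (ternaryDigit y = 1 ∧ 1 ≤ weightCarry α (α * y) (α * z)) then 1 else 0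

/-- The carry relation with nonnegative carries gives `c ≥ 1` whenever the digit is 1 or 2, so only
a digit 2 can exceed its carry, by 1, and the potential pays for it. If the potential at `α y` is 1,
the same relation supplies a larger carry; for digit 1 with zero carry at `α y`, the digit of `α y`
is 0 and nothing is lost. -/
theorem digit_le_carry_add_potential (hn : 2 * (n / 2) = n) (hα : α * α = 3)
    (h : α * y + 2 * y + z = (n / 2 : ℕ))
    (h' : α * (α * y) + 2 * (α * y) + α * z = (n / 2 : ℕ)) :
    (ternaryDigit y : ℤ) ≤ weightCarry α y z + weightPotential α y z
      - weightPotential α (α * y) (α * z) := by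
  have e (w : ZMod n) : α * (α * w) = 3 * w := by rw [← mul_assoc, hα]
  have h3 := three_pow_mul_relation hn h 1
  have h3' := three_pow_mul_relation hn h' 1
  rw [pow_one] at h3 h3'
  have r1 := three_mul_weightCarry hn h
  have r2 := three_mul_weightCarry hn h'
  have p1 := weightCarry_nonneg hn h
  have p2 := weightCarry_nonneg hn h'
  have p3 := weightCarry_nonneg hn h3
  have p4 := weightCarry_nonneg hn h3'
  have d1 := ternaryDigit_le_two y
  have d2 := ternaryDigit_le_two (α * y)
  simp only [weightPotential, e] at *
  split_ifs <;> omega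

/-- Summed over the orbit of multiplication by 3, the carry relation becomes `2 ∑ c = 3 wt(i) +
wt(j) - m`. In the local inequality the potentials cancel, so `wt(i) ≤ ∑ c`, which is what is
needed. -/
theorem le_ternaryWeight_add {m h : ℕ} (hn : 2 * (n / 2) = n) (h3 : (3 : ZMod n) ^ m = 1)
    (hα : (3 : ZMod n) ^ (h + 1) * 3 ^ (h + 1) = 3) {i j : ZMod n}
    (hij : 3 ^ (h + 1) * i + 2 * i + j = (n / 2 : ℕ)) :
    m ≤ ternaryWeight m i + ternaryWeight m j := by
  set α : ZMod n := 3 ^ (h + 1) with hαdef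
  have hk (k) := three_pow_mul_relation hn hij k
  have e (k : ℕ) (w : ZMod n) : α * (3 ^ k * w) = 3 ^ (k + (h + 1)) * w := by
    rw [hαdef]; ring
  have hper (k : ℕ) : (3 : ZMod n) ^ (k + m) = 3 ^ k := by rw [pow_add, h3, mul_one]
  let c : ℕ → ℤ := fun k => weightCarry α (3 ^ k * i) (3 ^ k * j)
  let φ : ℕ → ℤ := fun k => weightPotential α (3 ^ k * i) (3 ^ k * j)
  let d : ℕ → ℤ := fun k => ternaryDigit ((3 : ZMod n) ^ k * i)
  let d' : ℕ → ℤ := fun k => ternaryDigit ((3 : ZMod n) ^ k * j)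
  have hc : Function.Periodic c m := fun k => by simp only [c, hper]
  have hφ : Function.Periodic φ m := fun k => by simp only [φ, hper]
  have hd : Function.Periodic d m := fun k => by simp only [d, hper]
  have hle (k : ℕ) : d k ≤ c k + φ k - φ (k + (h + 1)) := by
    have := digit_le_carry_add_potential hn hα (hk k) (by
      rw [e k i, e k j]; exact hk _)
    rwa [e k i, e k j] at this
  have hrel (k : ℕ) : 3 * c k = c (k + 1) + d (k + (h + 1)) + 2 * d k + d' k - 1 := by
    have := three_mul_weightCarry hn (hk k)
    rwa [e, ← mul_assoc, ← mul_assoc, ← pow_succ'] at this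
  have s1 := Finset.sum_le_sum fun k (_ : k ∈ Finset.range m) => hle k
  have s2 := Finset.sum_congr rfl fun k (_ : k ∈ Finset.range m) => hrel k
  simp only [Finset.sum_sub_distrib, Finset.sum_add_distrib, ← Finset.mul_sum, Finset.sum_const,
    Finset.card_range, hφ.sum_range_add, hc.sum_range_add, hd.sum_range_add, nsmul_eq_mul,
    mul_one] at s1 s2
  have t1 : (ternaryWeight m i : ℤ) = ∑ k ∈ Finset.range m, d k := by simp [ternaryWeight, d]
  have t2 : (ternaryWeight m j : ℤ) = ∑ k ∈ Finset.range m, d' k := by simp [ternaryWeight, d']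
  zify
  rw [t1, t2]
  linarith

end ternary

/-! ### The trace in characteristic three -/

/-- The absolute trace of a field of characteristic three. -/
noncomputable def ternaryTrace (F : Type*) [Field F] [CharP F 3] : F →+ ZMod 3 :=
  letI := ZMod.algebra F 3
  (Algebra.trace (ZMod 3) F).toAddMonoidHom

section trace

variable {F : Type*} [Field F] [CharP F 3] [Fintype F] {m : ℕ}

theorem cast_ternaryTrace (hq : Fintype.card F = 3 ^ m) (x : F) :
    ((ternaryTrace F x).val : F) = ∑ i ∈ Finset.range m, x ^ 3 ^ i := by
  let := ZMod.algebra F 3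
  have : Fact (Nat.Prime 3) := ⟨by norm_num⟩
  have hm : Module.finrank (ZMod 3) F = m := by
    have := Module.card_eq_pow_finrank (K := ZMod 3) (V := F)
    rw [hq, ZMod.card] at this
    exact (Nat.pow_right_injective (by norm_num : 2 ≤ 3) this).symm
  have h := FiniteField.algebraMap_trace_eq_sum_pow (ZMod 3) F x
  rw [hm, Nat.card_zmod] at h
  rw [← h, ternaryTrace]
  change _ = algebraMap (ZMod 3) F (Algebra.trace (ZMod 3) F x)
  rw [← map_natCast (algebraMap (ZMod 3) F), ZMod.natCast_zmod_val]
  rfl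

theorem ternaryTrace_pow_three (hq : Fintype.card F = 3 ^ m) (x : F) :
    ternaryTrace F (x ^ 3) = ternaryTrace F x := by
  have h : ((ternaryTrace F (x ^ 3)).val : F) = (ternaryTrace F x).val := by
    rw [cast_ternaryTrace hq, cast_ternaryTrace hq, ← sub_eq_zero, ← Finset.sum_sub_distrib]
    simp only [← pow_mul, ← pow_succ']
    rw [Finset.sum_range_sub (fun i => x ^ 3 ^ i), ← hq, FiniteField.pow_card, pow_zero, pow_one,
      sub_self]
  exact ZMod.val_injective 3 (CharP.natCast_injOn_Iio F 3 (ZMod.val_lt _) (ZMod.val_lt _) h)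

theorem ternaryTrace_pow_three_pow (hq : Fintype.card F = 3 ^ m) (k : ℕ) (x : F) :
    ternaryTrace F (x ^ 3 ^ k) = ternaryTrace F x := by
  induction k with
  | zero => simp
  | succ k ih => rw [pow_succ, pow_mul, ternaryTrace_pow_three hq, ih]

/-- In `Tr x = ∑ x ^ 3 ^ i` only `i = 0` survives, contributing `q - 1 = -1`; the other power sums
have exponent below `q - 1` and vanish. -/
theorem sum_inv_mul_ternaryTrace (hq : Fintype.card F = 3 ^ m) :
    ∑ x : F, x⁻¹ * ((ternaryTrace F x).val : F) = -1 := by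
  have hm : m ≠ 0 := by
    rintro rfl
    have := Fintype.one_lt_card (α := F)
    omega
  simp only [cast_ternaryTrace hq, Finset.mul_sum]
  rw [Finset.sum_comm, Finset.sum_eq_single_of_mem 0 (Finset.mem_range.2 (Nat.pos_of_ne_zero hm))]
  · classical
    have (x : F) : x⁻¹ * x ^ 3 ^ 0 = 1 - if x = 0 then 1 else 0 := by
      by_cases hx : x = 0 <;> simp [hx]
    simp only [this, Finset.sum_sub_distrib, Finset.sum_ite_eq', Finset.mem_univ, if_true]
    simp
  · intro i hi hi0
    have h1 : 1 < 3 ^ i := Nat.one_lt_pow hi0 (by norm_num)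
    have h2 : 3 ^ i < 3 ^ m := Nat.pow_lt_pow_right (by norm_num) (Finset.mem_range.1 hi)
    rw [← FiniteField.sum_pow_lt_card_sub_one F (3 ^ i - 1) (by omega)]
    refine Finset.sum_congr rfl fun x _ => ?_
    by_cases hx : x = 0
    · rw [hx, inv_zero, zero_mul, zero_pow (by omega)]
    · field_simp
      rw [← pow_succ', Nat.sub_add_cancel h1.le]

end trace

/-! ### Gauss sums and Stickelberger's bound -/

namespace CubicTeichmullerRing

section basic

variable {F R : Type*} [Field F] [CommRing R] (T : CubicTeichmullerRing F R)

theorem omega_pow_three : T.omega ^ 3 = 1 := by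
  linear_combination (T.omega - 1) * T.omega_rel

theorem omega_sub_one_sq_dvd_three : (T.omega - 1) ^ 2 ∣ 3 :=
  ⟨-T.omega ^ 2, by
    linear_combination (-T.omega ^ 2 + 3 * T.omega - 3) * -T.omega_rel⟩

/-- The multiplicative character given by the multiplicative representatives. -/
def chi : MulChar F R :=
  { T.tau with
    map_nonunit' := fun x hx => by
      rw [isUnit_iff_ne_zero, not_not] at hx
      subst hx
      exact T.tau_zero }

theorem chi_apply (x : F) : T.chi x = T.tau x := rfl

theorem tau_injective : Function.Injective T.tau :=
  Function.LeftInverse.injective T.res_tau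

variable [CharP F 3]

theorem res_omega : T.res T.omega = 1 := by
  have h := congrArg T.res T.omega_rel
  simp only [map_add, map_pow, map_one, map_zero] at h
  have h3 : (3 : F) = 0 := by exact_mod_cast CharP.cast_eq_zero F 3
  have : (T.res T.omega - 1) ^ 2 = 0 := by linear_combination h - T.res T.omega * h3
  exact sub_eq_zero.1 (pow_eq_zero_iff two_ne_zero |>.1 this)

theorem dvd_iff (x : R) : T.omega - 1 ∣ x ↔ T.res x = 0 := by
  refine ⟨?_, T.dvd_of_res_eq_zero x⟩
  rintro ⟨y, rfl⟩
  rw [map_mul, map_sub, res_omega, map_one, sub_self, zero_mul]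

theorem prime_omega_sub_one : Prime (T.omega - 1) := by
  refine ⟨sub_ne_zero.2 T.omega_ne_one, fun h => ?_, fun a b h => ?_⟩
  · have := (T.dvd_iff 1).1 h.dvd
    simp at this
  · rw [dvd_iff, map_mul, mul_eq_zero] at h
    rwa [dvd_iff, dvd_iff]

/-- The additive character `x ↦ ω ^ Tr x`. -/
noncomputable def psi : AddChar F R :=
  (AddChar.zmodChar 3 T.omega_pow_three).compAddMonoidHom (ternaryTrace F)

theorem psi_apply (x : F) : T.psi x = T.omega ^ (ternaryTrace F x).val := rfl

theorem psi_eq_one_add (x : F) : T.psi x =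
    1 + (T.omega - 1) * ∑ i ∈ Finset.range (ternaryTrace F x).val, T.omega ^ i := by
  rw [mul_geom_sum, psi_apply]
  ring

end basic

section gauss

variable {F R : Type*} [Field F] [CommRing R] (T : CubicTeichmullerRing F R) [Fintype F]

theorem chi_pow_eq_one_iff (a : ℕ) : T.chi ^ a = 1 ↔ Fintype.card F - 1 ∣ a := by
  rw [← FiniteField.forall_pow_eq_one_iff, MulChar.ext_iff]
  refine forall_congr' fun x => ?_
  rw [MulChar.pow_apply_coe, MulChar.one_apply_coe, chi_apply, ← map_pow,
    ← T.tau.map_one, T.tau_injective.eq_iff, Units.ext_iff, Units.val_pow_eq_pow_val, Units.val_one]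

theorem chi_inv_pow_eq_one_iff (a : ℕ) : T.chi⁻¹ ^ a = 1 ↔ Fintype.card F - 1 ∣ a := by
  rw [inv_pow, inv_eq_one, chi_pow_eq_one_iff]

theorem sum_tau_pow [IsDomain R] {a : ℕ} (ha : ¬ Fintype.card F - 1 ∣ a) :
    ∑ y, T.tau y ^ a = 0 := by
  have h := MulChar.sum_eq_zero_of_ne_one (mt (T.chi_pow_eq_one_iff a).1 ha)
  rw [← h]
  refine Finset.sum_congr rfl fun y _ => ?_
  rw [MulChar.pow_apply' _ (by rintro rfl; exact ha (dvd_zero _)), chi_apply]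

variable [CharP F 3] {m : ℕ}

theorem psi_pow_three_pow (hq : Fintype.card F = 3 ^ m) (k : ℕ) (x : F) :
    T.psi (x ^ 3 ^ k) = T.psi x := by
  rw [psi_apply, psi_apply, ternaryTrace_pow_three_pow hq]

/-- The Gauss sum of the `a`-th power of the inverse of `chi`. -/
noncomputable def gauss (a : ℕ) : R := gaussSum (T.chi⁻¹ ^ a) T.psi

theorem gauss_three_mul (hq : Fintype.card F = 3 ^ m) (a : ℕ) : T.gauss (3 * a) = T.gauss a := by
  have : Fact (Nat.Prime 3) := ⟨by norm_num⟩
  rw [gauss, gauss, gaussSum, gaussSum]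
  refine Fintype.sum_bijective (frobenius F 3) (bijective_frobenius F 3) _ _ fun x => ?_
  have h := T.psi_pow_three_pow hq 1 x
  rw [pow_one] at h
  rw [frobenius_def, h, map_pow, mul_comm 3 a, pow_mul, MulChar.pow_apply' _ three_ne_zero]

variable [IsDomain R]

/-- Since `ψ(x) ≡ 1 + (ω - 1) Tr x` modulo `(ω - 1)²`, the quotient `g(1) / (ω - 1)` reduces to `∑
x⁻¹ Tr x = -1`. -/
theorem exists_gauss_one (hq : Fintype.card F = 3 ^ m) :
    ∃ u, ¬ (T.omega - 1 ∣ u) ∧ T.gauss 1 = (T.omega - 1) * u := by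
  refine ⟨∑ x : F, T.chi⁻¹ x * ∑ i ∈ Finset.range (ternaryTrace F x).val, T.omega ^ i, ?_, ?_⟩
  · rw [dvd_iff]
    simp only [map_sum, map_mul, map_pow, res_omega, one_pow, Finset.sum_const,
      Finset.card_range, MulChar.inv_apply', chi_apply, T.res_tau, nsmul_eq_mul, mul_one]
    rw [sum_inv_mul_ternaryTrace hq]
    exact neg_ne_zero.2 one_ne_zero
  · have h1 : T.chi⁻¹ ≠ 1 := fun h => by
      have h2 := (T.chi_inv_pow_eq_one_iff 1).1 (by rw [pow_one, h])
      rw [hq, Nat.dvd_one] at h2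
      have : m ≠ 0 := by rintro rfl; simp at h2
      have := Nat.pow_le_pow_right (n := 3) (by norm_num) (Nat.one_le_iff_ne_zero.2 this)
      omega
    have h2 := MulChar.sum_eq_zero_of_ne_one h1
    rw [gauss, gaussSum, pow_one]
    simp only [psi_eq_one_add, mul_add, mul_one, Finset.sum_add_distrib, h2, zero_add,
      Finset.mul_sum]
    refine Finset.sum_congr rfl fun x _ => Finset.sum_congr rfl fun i _ => ?_
    ring

theorem psi_ne_one (hq : Fintype.card F = 3 ^ m) : T.psi ≠ 1 := by
  intro h
  obtain ⟨u, hu, h1⟩ := T.exists_gauss_one hq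
  have hz : ∀ x, ternaryTrace F x = 0 := fun x => by
    have hx : T.psi x = 1 := by rw [h]; rfl
    rw [psi_apply] at hx
    have hlt := ZMod.val_lt (ternaryTrace F x)
    rw [← ZMod.val_eq_zero]
    have hω := T.omega_ne_one
    have hr := T.omega_rel
    interval_cases (ternaryTrace F x).val
    · rfl
    · exact absurd (by simpa using hx) hω
    · exfalso
      have : T.omega ^ 3 = T.omega := by rw [pow_succ, hx, one_mul]
      exact hω (this.symm.trans T.omega_pow_three)
  have := sum_inv_mul_ternaryTrace hq
  simp [hz] at this

theorem psi_isPrimitive (hq : Fintype.card F = 3 ^ m) : T.psi.IsPrimitive :=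
  AddChar.IsPrimitive.of_ne_one (T.psi_ne_one hq)

theorem gauss_zero (hq : Fintype.card F = 3 ^ m) : T.gauss 0 = -1 := by
  rw [gauss, pow_zero, gaussSum_one_left (T.psi_ne_one hq)]

/-- The quotient is a Jacobi sum. -/
theorem gauss_add_dvd {a b : ℕ} (h : ¬ Fintype.card F - 1 ∣ a + b) :
    T.gauss (a + b) ∣ T.gauss a * T.gauss b := by
  rw [gauss, gauss, gauss, ← jacobiSum_mul_nontrivial, pow_add]
  · exact Dvd.intro _ rfl
  · rwa [← pow_add, Ne, chi_inv_pow_eq_one_iff]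

theorem gauss_dvd_pow_add {a s d : ℕ} (h : T.gauss a ∣ T.gauss 1 ^ s)
    (hd : a + d < Fintype.card F - 1) : T.gauss (a + d) ∣ T.gauss 1 ^ (s + d) := by
  induction d with
  | zero => exact h
  | succ d ih =>
    refine (T.gauss_add_dvd (a := a + d) (b := 1) fun hdvd => ?_).trans ?_
    · exact (Nat.le_of_dvd (by omega) hdvd).not_gt hd
    · rw [← add_assoc, pow_succ]
      exact mul_dvd_mul_right (ih (by omega)) _

/-- Build `y` digit by digit: passing from `a` to `3 a` leaves the Gauss sum unchanged, and each
added unit costs one factor `g(1)`. -/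
theorem gauss_dvd_pow_weight (hq : Fintype.card F = 3 ^ m) {n : ℕ} [NeZero n]
    (hn : n + 1 = 3 ^ m) (y : ZMod n) : T.gauss y.val ∣ T.gauss 1 ^ ternaryWeight m y := by
  have hy := y.val_lt
  -- All prefixes stay below `n = q - 1`, so no trivial character occurs on the way.
  have hle (t : ℕ) (ht : t ≤ m) : 3 ^ t * y.val / n ≤ y.val := by
    refine Nat.lt_succ_iff.1 (Nat.div_lt_of_lt_mul ?_)
    calc 3 ^ t * y.val ≤ 3 ^ m * y.val :=
          Nat.mul_le_mul_right _ (Nat.pow_le_pow_right (by norm_num) ht)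
      _ < n * (y.val + 1) := by rw [← hn]; linarith
  have key (t : ℕ) (ht : t ≤ m) : T.gauss (3 ^ t * y.val / n) ∣
      T.gauss 1 ^ ∑ k ∈ Finset.range t, ternaryDigit ((3 : ZMod n) ^ k * y) := by
    induction t with
    | zero => simp [Nat.div_eq_of_lt hy, T.gauss_zero hq]
    | succ t ih =>
      have h1 := hle _ ht
      rw [ternaryPrefix_succ] at h1 ⊢
      rw [Finset.sum_range_succ]
      refine T.gauss_dvd_pow_add ?_ (by omega)
      rw [T.gauss_three_mul hq]
      exact ih (by omega)
  have h := key m le_rfl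
  have hval : 3 ^ m * y.val / n = y.val := by
    rw [← hn, add_mul, one_mul, Nat.mul_add_div (NeZero.pos n), Nat.div_eq_of_lt hy, add_zero]
  rwa [hval] at h

theorem card_dvd_gauss_mul_gauss (hq : Fintype.card F = 3 ^ m) {n : ℕ} [NeZero n]
    (hn : n + 1 = 3 ^ m) {y : ZMod n} (hy : y ≠ 0) :
    (3 : R) ^ m ∣ T.gauss (-y).val * T.gauss y.val := by
  have : NeZero y := ⟨hy⟩
  have hlt := y.val_lt
  have hpos : 0 < y.val := ZMod.val_pos.2 hy
  have hcard : Fintype.card F - 1 = n := by omega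
  have hne : T.chi⁻¹ ^ y.val ≠ 1 := by
    rw [Ne, chi_inv_pow_eq_one_iff, hcard]
    exact Nat.not_dvd_of_pos_of_lt hpos hlt
  have hinv : T.chi⁻¹ ^ (-y).val = (T.chi⁻¹ ^ y.val)⁻¹ := by
    rw [eq_inv_iff_mul_eq_one, ← pow_add, ZMod.val_neg_of_ne_zero, Nat.sub_add_cancel hlt.le,
      chi_inv_pow_eq_one_iff, hcard]
  have h1 := gaussSum_mul_gaussSum_eq_card hne (T.psi_isPrimitive hq)
  have h2 := mul_gaussSum_inv_eq_gaussSum (T.chi⁻¹ ^ y.val)⁻¹ T.psi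
  rw [gauss, gauss, hinv, ← h2, mul_assoc, mul_comm (gaussSum _ T.psi⁻¹), h1, hq]
  push_cast
  exact Dvd.intro_left _ rfl

/-- The lower bound in Stickelberger's theorem for the field `F` of `3 ^ m` elements. -/
theorem pow_weight_dvd_gauss (hq : Fintype.card F = 3 ^ m) {n : ℕ} [NeZero n]
    (hn : n + 1 = 3 ^ m) (h3 : IsUnit (3 : ZMod n)) (y : ZMod n) :
    (T.omega - 1) ^ ternaryWeight m y ∣ T.gauss y.val := by
  by_cases hy : y = 0
  · rw [hy, ternaryWeight_zero, pow_zero]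
    exact one_dvd _
  obtain ⟨u, hu, h1⟩ := T.exists_gauss_one hq
  have hw := ternaryWeight_add_neg (m := m) h3 hy
  have hp := T.prime_omega_sub_one
  -- `g(-y)` divides `g(1) ^ wt(-y)`, of valuation exactly `wt(-y)`, while `3 ^ m` divides `g(-y)
  -- g(y)`. As `wt(y) + wt(-y) = 2 m`, this upper bound at `-y` is a lower bound at `y`.
  have hd : (T.omega - 1) ^ (2 * m) ∣ T.gauss 1 ^ ternaryWeight m (-y) * T.gauss y.val := by
    rw [pow_mul]
    exact (pow_dvd_pow_of_dvd T.omega_sub_one_sq_dvd_three m).trans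
      ((T.card_dvd_gauss_mul_gauss hq hn hy).trans
        (mul_dvd_mul_right (T.gauss_dvd_pow_weight hq hn (-y)) _))
  rw [h1, mul_pow, mul_assoc, ← hw, add_comm, pow_add] at hd
  have hd' := (mul_dvd_mul_iff_left (pow_ne_zero _ hp.ne_zero)).1 hd
  exact hp.pow_dvd_of_dvd_mul_left _ (fun h => hu (hp.dvd_of_dvd_pow h)) hd'

end gauss

end CubicTeichmullerRing

/-! ### Divisibility of the exponential sums -/

namespace CubicTeichmullerRing

variable {F R : Type*} [Field F] [CommRing R] (T : CubicTeichmullerRing F R)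
  [Fintype F]

theorem not_dvd_card_sub_one [CharP F 3] : ¬ T.omega - 1 ∣ ((Fintype.card F - 1 : ℕ) : R) := by
  rw [dvd_iff, map_natCast, Nat.cast_sub Fintype.card_pos]
  simp

theorem tau_pow_card_sub_one {x : F} (hx : x ≠ 0) : T.tau x ^ (Fintype.card F - 1) = 1 := by
  rw [← map_pow, FiniteField.pow_card_sub_one_eq_one x hx, map_one]

variable [IsDomain R]

theorem sum_chi_inv_pow_mul {u : F} (hu : u ≠ 0) (x : F) [Decidable (x = u)] :
    ∑ k ∈ Finset.range (Fintype.card F - 1), (T.chi⁻¹ ^ k) x * T.tau u ^ k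
      = if x = u then ((Fintype.card F - 1 : ℕ) : R) else 0 := by
  by_cases hx : x = 0
  · rw [if_neg (by rw [hx]; exact hu.symm), hx]
    exact Finset.sum_eq_zero fun k _ => by rw [MulChar.map_zero, zero_mul]
  have h (k : ℕ) : (T.chi⁻¹ ^ k) x * T.tau u ^ k = T.tau (x⁻¹ * u) ^ k := by
    have := MulChar.pow_apply_coe T.chi⁻¹ k (Units.mk0 x hx)
    rw [Units.val_mk0] at this
    rw [this, MulChar.inv_apply', chi_apply, map_mul, mul_pow]
  simp only [h]
  split_ifs with hxu
  · subst hxu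
    simp [inv_mul_cancel₀ hx]
  · have hne : T.tau (x⁻¹ * u) ≠ 1 := by
      rw [← T.tau.map_one]
      refine T.tau_injective.ne fun h => hxu ?_
      field_simp at h
      exact h.symm
    have := mul_geom_sum (T.tau (x⁻¹ * u)) (Fintype.card F - 1)
    rw [T.tau_pow_card_sub_one (mul_ne_zero (inv_ne_zero hx) hu), sub_self] at this
    exact (mul_eq_zero.1 this).resolve_left (sub_ne_zero.2 hne)

variable [CharP F 3] {m : ℕ}

theorem sum_gauss_mul_tau_pow {u : F} (hu : u ≠ 0) :
    ∑ k ∈ Finset.range (Fintype.card F - 1), T.gauss k * T.tau u ^ k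
      = (Fintype.card F - 1 : ℕ) * T.psi u := by
  classical
  have h (k : ℕ) : T.gauss k * T.tau u ^ k
      = ∑ x, ((T.chi⁻¹ ^ k) x * T.tau u ^ k) * T.psi x := by
    rw [gauss, gaussSum, Finset.sum_mul]
    exact Finset.sum_congr rfl fun x _ => by ring
  simp only [h]
  rw [Finset.sum_comm]
  simp only [← Finset.sum_mul, T.sum_chi_inv_pow_mul hu, ite_mul, zero_mul, Finset.sum_ite_eq',
    Finset.mem_univ, if_true]

theorem pow_dvd_sub_sum_gauss (hq : Fintype.card F = 3 ^ m) (u : F) :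
    (T.omega - 1) ^ m ∣ (Fintype.card F - 1 : ℕ) * T.psi u
      - ∑ k ∈ Finset.range (Fintype.card F - 1), T.gauss k * T.tau u ^ k := by
  by_cases hu : u = 0
  -- At `u = 0` the expansion fails, because `0 ^ 0 = 1` leaves the term `g(0) = -1`; the error is
  -- `q = 3 ^ m`.
  · have hc : 1 < Fintype.card F := Fintype.one_lt_card
    rw [hu, T.tau_zero, Finset.sum_eq_single_of_mem 0 (Finset.mem_range.2 (by omega))
      fun k _ hk => by rw [zero_pow hk, mul_zero]]
    rw [pow_zero, AddChar.map_zero_eq_one, T.gauss_zero hq, Nat.cast_sub hc.le, hq]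
    have h : (((3 ^ m : ℕ) : R) - (1 : ℕ)) * 1 - -1 * 1 = 3 ^ m := by push_cast; ring
    rw [h]
    exact pow_dvd_pow_of_dvd ((dvd_pow_self _ two_ne_zero).trans T.omega_sub_one_sq_dvd_three) m
  · rw [T.sum_gauss_mul_tau_pow hu, sub_self]
    exact dvd_zero _

/-- Divisibility of exponential sums with the Welch exponent `3 ^ (h + 1) + 2`, twisted by the
quadratic character. -/
theorem pow_dvd_welch_sum {h : ℕ} (hq : Fintype.card F = 3 ^ (2 * h + 1)) (β γ : F) :
    (T.omega - 1) ^ (2 * h + 1) ∣ ∑ y : F, T.tau y ^ ((Fintype.card F - 1) / 2) *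
      (T.psi (β * y ^ (3 ^ (h + 1) + 2)) * T.psi (γ * y)) := by
  have hp := T.prime_omega_sub_one
  obtain ⟨n, hn⟩ : ∃ n, n = Fintype.card F - 1 := ⟨_, rfl⟩
  have hn1 : n + 1 = 3 ^ (2 * h + 1) := by
    have := Fintype.card_pos (α := F)
    omega
  have hn2 : 2 * (n / 2) = n := by
    have : Odd (n + 1) := by rw [hn1]; exact Odd.pow (by decide)
    have : Even n := by simpa [parity_simps] using this
    exact Nat.two_mul_div_two_of_even this
  have hnpos : NeZero n := ⟨by
    have := Fintype.one_lt_card (α := F)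
    omega⟩
  have h3m : (3 : ZMod n) ^ (2 * h + 1) = 1 := by
    have : ((n + 1 : ℕ) : ZMod n) = 1 := by simp
    rw [hn1] at this
    exact_mod_cast this
  have h3 : IsUnit (3 : ZMod n) := IsUnit.of_pow_eq_one h3m (by omega)
  have hα : (3 : ZMod n) ^ (h + 1) * 3 ^ (h + 1) = 3 := by
    rw [← pow_add, show h + 1 + (h + 1) = 2 * h + 1 + 1 by ring, pow_succ, h3m, one_mul]
  have hG (i : ℕ) (hi : i < n) :
      (T.omega - 1) ^ ternaryWeight (2 * h + 1) (i : ZMod n) ∣ T.gauss i := by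
    have := T.pow_weight_dvd_gauss hq hn1 h3 (i : ZMod n)
    rwa [ZMod.val_natCast, Nat.mod_eq_of_lt hi] at this
  have hE := T.pow_dvd_sub_sum_gauss hq
  have hnp := T.not_dvd_card_sub_one
  rw [← hn] at hE hnp ⊢
  set E : F → R := fun u => ∑ k ∈ Finset.range n, T.gauss k * T.tau u ^ k with hEdef
  have hmain : (T.omega - 1) ^ (2 * h + 1) ∣ ∑ y : F, T.tau y ^ (n / 2) *
      (E (β * y ^ (3 ^ (h + 1) + 2)) * E (γ * y)) := by
    have hexp : ∑ y : F, T.tau y ^ (n / 2) * (E (β * y ^ (3 ^ (h + 1) + 2)) * E (γ * y))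
        = ∑ i ∈ Finset.range n, ∑ j ∈ Finset.range n,
          (T.gauss i * T.gauss j) * ((T.tau β ^ i * T.tau γ ^ j) *
            ∑ y, T.tau y ^ (n / 2 + (3 ^ (h + 1) + 2) * i + j)) := by
      simp only [hEdef, Finset.sum_mul_sum]
      simp only [Finset.mul_sum, map_mul, map_pow]
      rw [Finset.sum_comm]
      refine Finset.sum_congr rfl fun i _ => ?_
      rw [Finset.sum_comm]
      refine Finset.sum_congr rfl fun j _ => Finset.sum_congr rfl fun y _ => ?_
      rw [pow_add, pow_add, pow_mul, mul_pow, mul_pow]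
      ring
    rw [hexp]
    refine Finset.dvd_sum fun i hi => Finset.dvd_sum fun j hj => ?_
    -- Orthogonality kills all terms but those with `(α + 2) i + j ≡ -n / 2 ≡ n / 2` modulo `n`,
    -- where the digit inequality applies.
    by_cases hd : n ∣ n / 2 + (3 ^ (h + 1) + 2) * i + j
    · refine Dvd.dvd.mul_right ?_ _
      have hz := (ZMod.natCast_eq_zero_iff _ n).2 hd
      have hhalf : ((2 * (n / 2) : ℕ) : ZMod n) = 0 := by rw [hn2, ZMod.natCast_self]
      have hle := le_ternaryWeight_add hn2 h3m hα (i := i) (j := j) (by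
        push_cast at hz hhalf
        linear_combination hz - hhalf)
      refine (pow_dvd_pow _ hle).trans ?_
      rw [pow_add]
      exact mul_dvd_mul (hG i (Finset.mem_range.1 hi)) (hG j (Finset.mem_range.1 hj))
    · rw [T.sum_tau_pow (by rwa [← hn]), mul_zero, mul_zero]
      exact dvd_zero _
  have hdiff : (T.omega - 1) ^ (2 * h + 1) ∣ (n : R) * (n * ∑ y : F, T.tau y ^ (n / 2) *
      (T.psi (β * y ^ (3 ^ (h + 1) + 2)) * T.psi (γ * y))) := by
    rw [← dvd_sub_left hmain, Finset.mul_sum, Finset.mul_sum, ← Finset.sum_sub_distrib]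
    refine Finset.dvd_sum fun y _ => ?_
    have := dvd_mul_sub_mul (hE (β * y ^ (3 ^ (h + 1) + 2))) (hE (γ * y))
    refine (Dvd.dvd.mul_left this (T.tau y ^ (n / 2))).trans (dvd_of_eq ?_)
    ring
  exact hp.pow_dvd_of_dvd_mul_left _ hnp (hp.pow_dvd_of_dvd_mul_left _ hnp hdiff)

theorem pow_dvd_reeTits_sum {h : ℕ} (hq : Fintype.card F = 3 ^ (2 * h + 1)) (a b : F) :
    (T.omega - 1) ^ (2 * h + 1) ∣ ∑ y : F, T.tau y ^ ((Fintype.card F - 1) / 2) *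
      T.psi (b * reeTitsMap (3 ^ (h + 1)) a y) := by
  obtain ⟨e, rfl⟩ := (bijective_iterateFrobenius F 3 (h + 1)).surjective b
  have hc : Nat.card F = 3 ^ (2 * h + 1) := by rw [Nat.card_eq_fintype_card, hq]
  have hσ := iterateFrobenius_iterateFrobenius_of_card hc
  have hψ (x : F) : T.psi (iterateFrobenius F 3 (h + 1) x) = T.psi x := by
    rw [iterateFrobenius_def, T.psi_pow_three_pow hq]
  refine (T.pow_dvd_welch_sum hq e (e * a - iterateFrobenius F 3 (h + 1) e * a ^ 2)).trans
    (dvd_of_eq (Finset.sum_congr rfl fun y _ => ?_))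
  congr 1
  -- With `b = σ(e)`, the first term is `σ(e y ^ (α + 2))` because `σ(y ^ α) = y³`; `ψ` does not see
  -- the outer `σ`.
  have h1 : iterateFrobenius F 3 (h + 1) e * reeTitsMap (3 ^ (h + 1)) a y =
      iterateFrobenius F 3 (h + 1) (e * (y ^ (3 ^ (h + 1) + 2))) +
        (iterateFrobenius F 3 (h + 1) (e * a * y)
          + -(iterateFrobenius F 3 (h + 1) e * a ^ 2 * y)) := by
    rw [reeTitsMap_eq, pow_add, ← iterateFrobenius_def 3 (h + 1) y]
    simp only [map_mul, map_pow, hσ]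
    ring
  rw [h1, AddChar.map_add_eq_mul, AddChar.map_add_eq_mul, hψ, hψ, ← AddChar.map_add_eq_mul T.psi (e * a * y)]
  congr 2
  ring

end CubicTeichmullerRing

/-! ### Character sums of skew sets -/

theorem sum_eq_of_skew {F M : Type*} [AddCommGroup F] [Fintype F] [DecidableEq F]
    [AddCommMonoid M] {D : Finset F} (hD0 : 0 ∉ D) (hD : ∀ u ≠ 0, u ∈ D ↔ -u ∉ D) (f : F → M) :
    ∑ u, f u = f 0 + ∑ u ∈ D, (f u + f (-u)) := by
  have hc : Dᶜ = insert 0 (D.map (Equiv.neg F).toEmbedding) := by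
    ext x
    by_cases hx : x = 0
    · simp [hx, hD0]
    · have := hD x hx
      simp only [Finset.mem_compl, Finset.mem_insert, Finset.mem_map_equiv, Equiv.neg_symm,
        Equiv.neg_apply]
      tauto
  rw [← Finset.sum_add_sum_compl D, hc, Finset.sum_insert (by simp [hD0]), Finset.sum_map,
    Finset.sum_add_distrib]
  simp only [Equiv.coe_toEmbedding, Equiv.neg_apply]
  rw [add_left_comm]

theorem card_eq_two_mul_add_one_of_skew {F : Type*} [AddCommGroup F] [Fintype F]
    [DecidableEq F] {D : Finset F} (hD0 : 0 ∉ D) (hD : ∀ u ≠ 0, u ∈ D ↔ -u ∉ D) :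
    Fintype.card F = 2 * D.card + 1 := by
  have := sum_eq_of_skew hD0 hD (fun _ => 1)
  simp only [Finset.sum_const, smul_eq_mul, Finset.card_univ] at this
  omega

namespace CubicTeichmullerRing

variable {F R : Type*} [Field F] [CommRing R] (T : CubicTeichmullerRing F R)

theorem pow_sub_pow_neg (t : ZMod 3) :
    T.omega ^ t.val - T.omega ^ (-t).val = (t.valMinAbs : R) * (T.omega - T.omega ^ 2) := by
  have h1 : (1 : ZMod 3).val = 1 := rfl
  have h2 : (2 : ZMod 3).val = 2 := rfl
  have h3 : (-1 : ZMod 3) = 2 := rfl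
  have h4 : (-2 : ZMod 3) = 1 := rfl
  have h5 : (1 : ZMod 3).valMinAbs = 1 := rfl
  have h6 : (2 : ZMod 3).valMinAbs = -1 := rfl
  obtain rfl | rfl | rfl : t = 0 ∨ t = 1 ∨ t = 2 := by revert t; decide
  · simp
  · rw [h1, h3, h2, h5]; push_cast; ring
  · rw [h2, h4, h1, h6]; push_cast; ring

theorem pow_add_pow_neg (t : ZMod 3) :
    T.omega ^ t.val + T.omega ^ (-t).val = 2 - 3 * (t.valMinAbs : R) ^ 2 := by
  have h1 : (1 : ZMod 3).val = 1 := rfl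
  have h2 : (2 : ZMod 3).val = 2 := rfl
  have h3 : (-1 : ZMod 3) = 2 := rfl
  have h4 : (-2 : ZMod 3) = 1 := rfl
  have h5 : (1 : ZMod 3).valMinAbs = 1 := rfl
  have h6 : (2 : ZMod 3).valMinAbs = -1 := rfl
  have := T.omega_rel
  obtain rfl | rfl | rfl : t = 0 ∨ t = 1 ∨ t = 2 := by revert t; decide
  · simp; norm_num
  · rw [h1, h3, h2, h5]; push_cast; linear_combination this
  · rw [h2, h4, h1, h6]; push_cast; linear_combination this

variable [CharP F 3]

/-- `(ω - 1)² = -3 ω`, and an integer divisible by `ω - 1` vanishes in characteristic 3, so it is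
divisible by 3. -/
theorem three_pow_dvd_of_pow_dvd [IsDomain R] {k : ℕ} {N : ℤ}
    (h : (T.omega - 1) ^ (2 * k) ∣ (N : R)) : 3 ^ k ∣ N := by
  have hp := T.prime_omega_sub_one
  induction k generalizing N with
  | zero => simp
  | succ k ih =>
    have h1 : T.omega - 1 ∣ (N : R) := (dvd_pow_self _ (by omega)).trans h
    rw [dvd_iff, map_intCast, CharP.intCast_eq_zero_iff F 3] at h1
    obtain ⟨N, rfl⟩ := h1
    push_cast
    rw [pow_succ']
    refine mul_dvd_mul_left 3 (ih ?_)
    refine (mul_dvd_mul_iff_left (pow_ne_zero 2 hp.ne_zero)).1 ?_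
    rw [← pow_add, show 2 + 2 * k = 2 * (k + 1) by ring]
    have : (T.omega - 1) ^ 2 * (N : R) = -T.omega * ((3 * N : ℤ) : R) := by
      push_cast
      linear_combination (N : R) * T.omega_rel
    rw [this]
    exact h.mul_left _

/-- The character sum of `D` at the additive character `x ↦ ψ (b x)`. -/
noncomputable def charSum (D : Finset F) (b : F) : R := ∑ d ∈ D, T.psi (b * d)

/-- The integer `N` such that `charSum D b - charSum D (-b) = N (ω - ω ^ 2)`. -/
noncomputable def skewSum (D : Finset F) (b : F) : ℤ :=
  ∑ d ∈ D, (ternaryTrace F (b * d)).valMinAbs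

variable {D : Finset F}

theorem charSum_neg (b : F) : T.charSum D (-b) = ∑ d ∈ D, T.psi (-(b * d)) :=
  Finset.sum_congr rfl fun d _ => by rw [neg_mul]

theorem charSum_sub_charSum_neg (b : F) :
    T.charSum D b - T.charSum D (-b) = (skewSum D b : R) * (T.omega - T.omega ^ 2) := by
  rw [charSum_neg, charSum, ← Finset.sum_sub_distrib, skewSum, Int.cast_sum, Finset.sum_mul]
  refine Finset.sum_congr rfl fun d _ => ?_
  rw [psi_apply, psi_apply, map_neg, pow_sub_pow_neg]

theorem charSum_zero : T.charSum D 0 = D.card := by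
  simp [charSum]

/-- `ω - ω² = -ω (ω - 1)` accounts for exactly one factor `ω - 1`. -/
theorem three_pow_dvd_skewSum [IsDomain R] {h : ℕ} {b : F}
    (hdvd : (T.omega - 1) ^ (2 * h + 1) ∣ T.charSum D b - T.charSum D (-b)) :
    3 ^ h ∣ skewSum D b := by
  refine T.three_pow_dvd_of_pow_dvd ?_
  refine (mul_dvd_mul_iff_right T.prime_omega_sub_one.ne_zero).1 ?_
  rw [← pow_succ]
  have h1 : (skewSum D b : R) * (T.omega - 1)
      = -T.omega ^ 2 * (T.charSum D b - T.charSum D (-b)) := by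
    rw [charSum_sub_charSum_neg]
    linear_combination (-(skewSum D b : R) * (T.omega - 1)) * T.omega_pow_three
  rw [h1]
  exact hdvd.mul_left _

variable [Fintype F] [DecidableEq F] [IsDomain R] {m : ℕ}

theorem sum_psi_mul (hq : Fintype.card F = 3 ^ m) (u : F) :
    ∑ b, T.psi (b * u) = if u = 0 then (Fintype.card F : R) else 0 := by
  rw [AddChar.sum_mulShift u (T.psi_isPrimitive hq)]
  split_ifs <;> simp

theorem charSum_add_charSum_neg (hq : Fintype.card F = 3 ^ m) (hD0 : 0 ∉ D)
    (hD : ∀ u ≠ 0, u ∈ D ↔ -u ∉ D) {b : F} (hb : b ≠ 0) :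
    T.charSum D b + T.charSum D (-b) = -1 := by
  have h1 := T.sum_psi_mul hq b
  rw [if_neg hb, sum_eq_of_skew hD0 hD] at h1
  rw [charSum_neg, charSum, ← Finset.sum_add_distrib]
  simp only [mul_comm _ b, mul_zero, AddChar.map_zero_eq_one, mul_neg] at h1
  linear_combination h1

theorem four_mul_charSum_mul (hq : Fintype.card F = 3 ^ m) (hD0 : 0 ∉ D)
    (hD : ∀ u ≠ 0, u ∈ D ↔ -u ∉ D) {b : F} (hb : b ≠ 0) :
    4 * (T.charSum D b * T.charSum D (-b)) = 1 + 3 * (skewSum D b : R) ^ 2 := by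
  have h1 := T.charSum_add_charSum_neg hq hD0 hD hb
  have h2 := T.charSum_sub_charSum_neg (D := D) b
  have h3 : (T.omega - T.omega ^ 2) ^ 2 = -3 := by
    linear_combination (T.omega ^ 2 - 3 * T.omega + 3) * T.omega_rel
  have h4 := congrArg (· ^ 2) h1
  have h5 := congrArg (· ^ 2) h2
  simp only [mul_pow, h3] at h4 h5
  linear_combination h4 - h5

/-- With `t ∈ {0, 1, -1}` the trace values, the sum relation gives `∑ t² = (2 |D| + 1) / 3 = q / 3`,
which is odd, and `t² ≡ t` modulo 2. -/
theorem odd_skewSum [CharZero R] (T : CubicTeichmullerRing F R)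
    (hq : Fintype.card F = 3 ^ (m + 1)) (hD0 : 0 ∉ D) (hD : ∀ u ≠ 0, u ∈ D ↔ -u ∉ D) {b : F} (hb : b ≠ 0) : Odd (skewSum D b) := by
  have h1 := T.charSum_add_charSum_neg hq hD0 hD hb
  rw [charSum_neg, charSum, ← Finset.sum_add_distrib] at h1
  simp only [psi_apply, map_neg, pow_add_pow_neg, Finset.sum_sub_distrib, Finset.sum_const,
    ← Finset.mul_sum, nsmul_eq_mul] at h1
  have h2 : (D.card : ℤ) * 2 - 3 * ∑ d ∈ D, (ternaryTrace F (b * d)).valMinAbs ^ 2 = -1 := by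
    exact_mod_cast h1
  have h3 := card_eq_two_mul_add_one_of_skew hD0 hD
  rw [hq, pow_succ] at h3
  have h4 : ∑ d ∈ D, (ternaryTrace F (b * d)).valMinAbs ^ 2 = 3 ^ m := by
    zify at h3
    linarith
  have h5 : Odd (∑ d ∈ D, (ternaryTrace F (b * d)).valMinAbs ^ 2) := by
    rw [h4]
    exact Odd.pow (by decide)
  have h6 : Even (∑ d ∈ D, (ternaryTrace F (b * d)).valMinAbs ^ 2 - skewSum D b) := by
    rw [skewSum, ← Finset.sum_sub_distrib]
    refine Finset.even_sum _ fun d _ => ?_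
    rw [sq, ← mul_sub_one]
    exact Int.even_mul_pred_self _
  have := h5.sub_even h6
  rwa [sub_sub_cancel] at this

/-- Fourier inversion of the autocorrelation of `D`; `g = 0` is Parseval's identity. -/
theorem sum_charSum_mul (hq : Fintype.card F = 3 ^ m) (g : F) :
    ∑ b, T.charSum D b * T.charSum D (-b) * T.psi (-(b * g))
      = Fintype.card F * ((D ×ˢ D).filter fun p => p.1 - p.2 = g).card := by
  have h1 (b : F) : T.charSum D b * T.charSum D (-b) * T.psi (-(b * g))
      = ∑ p ∈ D ×ˢ D, T.psi (b * (p.1 - p.2 - g)) := by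
    rw [charSum_neg, charSum, Finset.sum_mul_sum, ← Finset.sum_product', Finset.sum_mul]
    refine Finset.sum_congr rfl fun p _ => ?_
    rw [← AddChar.map_add_eq_mul, ← AddChar.map_add_eq_mul]
    congr 1
    ring
  simp only [h1]
  rw [Finset.sum_comm]
  simp only [T.sum_psi_mul hq, sub_eq_zero]
  rw [← Finset.sum_filter, Finset.sum_const, nsmul_eq_mul, mul_comm]

theorem sum_skewSum_sq [CharZero R] (T : CubicTeichmullerRing F R)
    (hq : Fintype.card F = 3 ^ (m + 1)) (hD0 : 0 ∉ D) (hD : ∀ u ≠ 0, u ∈ D ↔ -u ∉ D) :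
    ∑ b ∈ Finset.univ.erase (0 : F), skewSum D b ^ 2 = ∑ _b ∈ Finset.univ.erase (0 : F), 3 ^ m := by
  have h1 := T.sum_charSum_mul (D := D) hq 0
  have h2 : ((D ×ˢ D).filter fun p => p.1 - p.2 = 0).card = D.card := by
    rw [← Finset.diag_card D]
    congr 1
    ext ⟨x, y⟩
    simp only [Finset.mem_filter, Finset.mem_product, Finset.mem_diag, sub_eq_zero]
    constructor
    · rintro ⟨⟨h, -⟩, h'⟩
      exact ⟨h, h'⟩
    · rintro ⟨h, rfl⟩
      exact ⟨⟨h, h⟩, rfl⟩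
  rw [h2, ← Finset.add_sum_erase _ _ (Finset.mem_univ (0 : F))] at h1
  simp only [mul_zero, neg_zero, AddChar.map_zero_eq_one, mul_one, charSum_zero] at h1
  have h3 : ∑ b ∈ Finset.univ.erase (0 : F), 4 * (T.charSum D b * T.charSum D (-b))
      = ∑ b ∈ Finset.univ.erase (0 : F), (1 + 3 * (skewSum D b : R) ^ 2) :=
    Finset.sum_congr rfl fun b hb => T.four_mul_charSum_mul hq hD0 hD (Finset.ne_of_mem_erase hb)
  have hcard := card_eq_two_mul_add_one_of_skew hD0 hD
  have h4 : (Finset.univ.erase (0 : F)).card = 2 * D.card := by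
    rw [Finset.card_erase_of_mem (Finset.mem_univ _), Finset.card_univ, hcard]
    rfl
  rw [← Finset.mul_sum, Finset.sum_add_distrib, ← Finset.mul_sum, Finset.sum_const, h4,
    nsmul_eq_mul, mul_one] at h3
  have h5 : 4 * ((Fintype.card F : ℤ) * D.card - D.card * D.card) = (2 * D.card : ℕ)
      + 3 * ∑ b ∈ Finset.univ.erase (0 : F), skewSum D b ^ 2 := by
    have : 4 * ((Fintype.card F : R) * D.card - D.card * D.card) = (2 * D.card : ℕ)
        + 3 * ∑ b ∈ Finset.univ.erase (0 : F), (skewSum D b : R) ^ 2 := by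
      linear_combination h3 - 4 * h1
    exact_mod_cast this
  rw [Finset.sum_const, h4, nsmul_eq_mul]
  rw [hq, pow_succ] at hcard h5
  push_cast at h5 ⊢
  have h6 : (3 : ℤ) ^ m * 3 = 2 * D.card + 1 := by exact_mod_cast hcard
  refine mul_left_cancel₀ (three_ne_zero (α := ℤ)) ?_
  linear_combination -h5 + 2 * (D.card : ℤ) * h6

/-- Each `N` is an odd, hence nonzero, multiple of `3 ^ h`, so `N²` is at least its mean `3 ^ (2
h)`; equality must hold throughout. -/
theorem skewSum_sq [CharZero R] {h : ℕ} (hq : Fintype.card F = 3 ^ (2 * h + 1)) (hD0 : 0 ∉ D)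
    (hD : ∀ u ≠ 0, u ∈ D ↔ -u ∉ D)
    (hdvd : ∀ b, (T.omega - 1) ^ (2 * h + 1) ∣ T.charSum D b - T.charSum D (-b))
    {b : F} (hb : b ≠ 0) : skewSum D b ^ 2 = 3 ^ (2 * h) := by
  have hle : ∀ b ∈ Finset.univ.erase (0 : F), (3 : ℤ) ^ (2 * h) ≤ skewSum D b ^ 2 := by
    intro b hb
    obtain ⟨c, hc⟩ := T.three_pow_dvd_skewSum (hdvd b)
    have hodd := T.odd_skewSum hq hD0 hD (Finset.ne_of_mem_erase hb)
    have hc0 : c ≠ 0 := by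
      rintro rfl
      rw [hc, mul_zero] at hodd
      exact absurd hodd (by decide)
    have hc1 : 1 ≤ c ^ 2 := Int.add_one_le_iff.2 (sq_pos_of_ne_zero hc0)
    rw [hc, mul_pow, ← pow_mul, mul_comm h 2]
    exact le_mul_of_one_le_right (by positivity) hc1
  exact (((Finset.sum_eq_sum_iff_of_le hle).1 (T.sum_skewSum_sq hq hD0 hD).symm) b
    (Finset.mem_erase.2 ⟨hb, Finset.mem_univ _⟩)).symm

/-- By `skewSum_sq`, the product of the two character sums is `(1 + q) / 4` at every `b ≠ 0`;
inversion then gives a count independent of `g`. -/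
theorem four_mul_card_differences [CharZero R] {h : ℕ} (hq : Fintype.card F = 3 ^ (2 * h + 1))
    (hD0 : 0 ∉ D) (hD : ∀ u ≠ 0, u ∈ D ↔ -u ∉ D)
    (hdvd : ∀ b, (T.omega - 1) ^ (2 * h + 1) ∣ T.charSum D b - T.charSum D (-b))
    {g : F} (hg : g ≠ 0) :
    4 * ((D ×ˢ D).filter fun p => p.1 - p.2 = g).card + 3 = Fintype.card F := by
  have h1 := T.sum_charSum_mul (D := D) hq g
  rw [← Finset.add_sum_erase _ _ (Finset.mem_univ (0 : F))] at h1
  simp only [neg_zero, zero_mul, AddChar.map_zero_eq_one, mul_one, charSum_zero] at h1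
  have h3 : ∑ b ∈ Finset.univ.erase (0 : F),
        4 * (T.charSum D b * T.charSum D (-b) * T.psi (-(b * g)))
      = ∑ b ∈ Finset.univ.erase (0 : F), (1 + Fintype.card F) * T.psi (b * -g) := by
    refine Finset.sum_congr rfl fun b hb => ?_
    have h4 := T.four_mul_charSum_mul hq hD0 hD (Finset.ne_of_mem_erase hb)
    have h5 := T.skewSum_sq hq hD0 hD hdvd (Finset.ne_of_mem_erase hb)
    have h6 : (skewSum D b : R) ^ 2 = 3 ^ (2 * h) := by exact_mod_cast h5
    rw [← mul_assoc, h4, h6, hq, mul_neg]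
    push_cast
    ring
  have h7 := T.sum_psi_mul hq (-g)
  rw [if_neg (neg_ne_zero.2 hg), ← Finset.add_sum_erase _ _ (Finset.mem_univ (0 : F)), zero_mul,
    AddChar.map_zero_eq_one] at h7
  rw [← Finset.mul_sum, ← Finset.mul_sum] at h3
  have hcard : (Fintype.card F : R) = 2 * D.card + 1 := by
    exact_mod_cast card_eq_two_mul_add_one_of_skew hD0 hD
  have h8 : (Fintype.card F : R) *
      (4 * ((D ×ˢ D).filter fun p => p.1 - p.2 = g).card + 3) =
      Fintype.card F * Fintype.card F := by
    linear_combination -4 * h1 + h3 + (1 + (Fintype.card F : R)) * h7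
      + (-2 * (D.card : R) - Fintype.card F + 1) * hcard
  have h9 := mul_left_cancel₀ (Nat.cast_ne_zero.2 Fintype.card_ne_zero) h8
  exact_mod_cast h9

end CubicTeichmullerRing

/-! ### The set `D_a` -/

theorem card_half_of_card_eq {F : Type*} [Fintype F] {h : ℕ}
    (hq : Fintype.card F = 3 ^ (2 * h + 1)) :
    ∃ k, Fintype.card F / 2 = 2 * k + 1 ∧ (Fintype.card F - 1) / 2 = 2 * k + 1 ∧
      Fintype.card F - 1 = 2 * (2 * k + 1) := by
  have h4 : 3 ^ (2 * h + 1) % 4 = 3 := by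
    rw [pow_succ, pow_mul, Nat.mul_mod, Nat.pow_mod]
    norm_num
  rw [← hq] at h4
  exact ⟨Fintype.card F / 4, by omega, by omega, by omega⟩

theorem ringChar_ne_two_of_charP_three {F : Type*} [Field F] [CharP F 3] : ringChar F ≠ 2 := by
  rw [ringChar.eq F 3]
  norm_num

theorem reeTitsMap_zero {F : Type*} [Field F] (α : ℕ) (hα : α ≠ 0) (a : F) : reeTitsMap α a 0 = 0 := by
  simp [reeTitsMap, hα]

theorem CubicTeichmullerRing.tau_neg_one {F R : Type*} [Field F] [CharP F 3] [CommRing R] [IsDomain R]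
    (T : CubicTeichmullerRing F R) : T.tau (-1) = -1 := by
  have h1 : T.tau (-1) ^ 2 = 1 := by rw [← map_pow, neg_one_sq, map_one]
  rcases sq_eq_one_iff.1 h1 with h2 | h2
  · rw [← T.tau.map_one] at h2
    exact absurd (T.tau_injective h2)
      (Ring.neg_one_ne_one_of_char_ne_two ringChar_ne_two_of_charP_three)
  · exact h2

section

variable {F : Type*} [Field F] [Fintype F] [CharP F 3] {h : ℕ}

theorem isSquare_iff_not_isSquare_neg (hq : Fintype.card F = 3 ^ (2 * h + 1)) {y : F}
    (hy : y ≠ 0) : IsSquare y ↔ ¬ IsSquare (-y) := by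
  obtain ⟨k, hk, -⟩ := card_half_of_card_eq hq
  have hF : ringChar F ≠ 2 := ringChar_ne_two_of_charP_three
  have h2 : (-1 : F) ≠ 1 := Ring.neg_one_ne_one_of_char_ne_two hF
  rw [FiniteField.isSquare_iff hF hy, FiniteField.isSquare_iff hF (neg_ne_zero.2 hy), hk,
    (odd_two_mul_add_one k).neg_pow, ← hk]
  rcases FiniteField.pow_dichotomy hF hy with h1 | h1
  · simp [h1, h2]
  · simp [h1, h2]

theorem reeTitsMap_mem_reeTitsSet (hq : Fintype.card F = 3 ^ (2 * h + 1)) {a : F} (ha : a ≠ 0)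
    {y : F} (hy : y ≠ 0) :
    reeTitsMap (3 ^ (h + 1)) a y ∈ reeTitsSet (3 ^ (h + 1)) a ↔ IsSquare y := by
  have hinj := reeTitsMap_injective (by rw [Nat.card_eq_fintype_card, hq]) ha
  constructor
  · rintro ⟨x, -, hx⟩
    exact ⟨x, by rw [← sq, hinj hx]⟩
  · rintro ⟨x, rfl⟩
    exact ⟨x, fun h0 => hy (by rw [h0, mul_zero]), by rw [sq]⟩

theorem zero_notMem_reeTitsSet (hq : Fintype.card F = 3 ^ (2 * h + 1)) {a : F} (ha : a ≠ 0) :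
    (0 : F) ∉ reeTitsSet (3 ^ (h + 1)) a := by
  have hinj := reeTitsMap_injective (by rw [Nat.card_eq_fintype_card, hq]) ha
  rintro ⟨x, hx, h0⟩
  rw [← reeTitsMap_zero (3 ^ (h + 1)) (by positivity) a] at h0
  exact hx (pow_eq_zero_iff two_ne_zero |>.1 (hinj h0))

theorem mem_reeTitsSet_iff_neg_notMem (hq : Fintype.card F = 3 ^ (2 * h + 1)) {a : F}
    (ha : a ≠ 0) {u : F} (hu : u ≠ 0) :
    u ∈ reeTitsSet (3 ^ (h + 1)) a ↔ -u ∉ reeTitsSet (3 ^ (h + 1)) a := by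
  have hinj := reeTitsMap_injective (by rw [Nat.card_eq_fintype_card, hq]) ha
  obtain ⟨y, rfl⟩ := (Finite.injective_iff_surjective.1 hinj) u
  have hy : y ≠ 0 := by
    rintro rfl
    exact hu (reeTitsMap_zero _ (by positivity) a)
  rw [← reeTitsMap_neg, reeTitsMap_mem_reeTitsSet hq ha hy,
    reeTitsMap_mem_reeTitsSet hq ha (neg_ne_zero.2 hy), isSquare_iff_not_isSquare_neg hq hy]

namespace CubicTeichmullerRing

variable {R : Type*} [CommRing R] [IsDomain R] (T : CubicTeichmullerRing F R)

/-- Substitute `u = f_a(y)`: squares `y` land in `D` with sign 1, nonsquares in `-D` with sign `-1`,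
so the twisted sum is the difference of the two character sums. -/
theorem pow_dvd_charSum_sub (hq : Fintype.card F = 3 ^ (2 * h + 1)) {a : F} (ha : a ≠ 0)
    [DecidableEq F] {D : Finset F} (hD : ∀ u, u ∈ D ↔ u ∈ reeTitsSet (3 ^ (h + 1)) a) (b : F) :
    (T.omega - 1) ^ (2 * h + 1) ∣ T.charSum D b - T.charSum D (-b) := by
  have hinj := reeTitsMap_injective (by rw [Nat.card_eq_fintype_card, hq]) ha
  obtain ⟨k, -, hk, hk'⟩ := card_half_of_card_eq hq
  refine (T.pow_dvd_reeTits_sum hq a b).trans (dvd_of_eq ?_)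
  let e : F ≃ F := Equiv.ofBijective _ (Finite.injective_iff_bijective.1 hinj)
  have he (y : F) : reeTitsMap (3 ^ (h + 1)) a y = e y := rfl
  have he0 : e.symm 0 = 0 := by
    rw [Equiv.symm_apply_eq, ← he, reeTitsMap_zero _ (by positivity)]
  have h1 := e.sum_comp fun u => T.tau (e.symm u) ^ ((Fintype.card F - 1) / 2) * T.psi (b * u)
  simp only [Equiv.symm_apply_apply] at h1
  simp only [he]
  rw [h1, sum_eq_of_skew (D := D) (by rw [hD]; exact zero_notMem_reeTitsSet hq ha)
    fun u hu => by rw [hD, hD]; exact mem_reeTitsSet_iff_neg_notMem hq ha hu]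
  rw [he0, T.tau_zero, hk, zero_pow (by omega), zero_mul, zero_add, charSum_neg, charSum,
    ← Finset.sum_sub_distrib]
  refine Finset.sum_congr rfl fun u hu => ?_
  obtain ⟨x, hx, rfl⟩ := (hD u).1 hu
  rw [← reeTitsMap_neg, he, he, Equiv.symm_apply_apply, Equiv.symm_apply_apply, ← he, ← he,
    reeTitsMap_neg, neg_eq_neg_one_mul (x ^ 2), T.tau.map_mul, T.tau.map_pow, mul_pow, ← pow_mul, ← hk',
    T.tau_pow_card_sub_one hx, T.tau_neg_one, (odd_two_mul_add_one k).neg_one_pow, mul_neg]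
  ring

end CubicTeichmullerRing

end

theorem theorem3p3 {F : Type*} [Field F] [Finite F] (h : ℕ)
    (hq : Nat.card F = 3 ^ (2 * h + 1)) (a : F) (ha : a ≠ 0) :
    IsSkewHadamardDifferenceSet (reeTitsSet (3 ^ (h + 1)) a) := by
  classical
  have := Fintype.ofFinite F
  have hq' : Fintype.card F = 3 ^ (2 * h + 1) := by rw [← Nat.card_eq_fintype_card, hq]
  have hp3 : Fact (Nat.Prime 3) := ⟨by norm_num⟩
  have hchar : CharP F 3 := charP_of_card_eq_prime_pow (f := 2 * h + 1) hq'
  have hneg := fun u (hu : u ≠ 0) => mem_reeTitsSet_iff_neg_notMem hq' ha hu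
  have h0 := zero_notMem_reeTitsSet hq' ha
  obtain ⟨R, _, _, _, ⟨T⟩⟩ := exists_cubicTeichmullerRing F
  let D : Finset F := (reeTitsSet (3 ^ (h + 1)) a).toFinset
  have hD : ∀ u, u ∈ D ↔ u ∈ reeTitsSet (3 ^ (h + 1)) a := fun u => Set.mem_toFinset
  have key {g : F} (hg : g ≠ 0) := T.four_mul_card_differences hq' (D := D) (by rwa [hD])
    (fun u hu => by rw [hD, hD]; exact hneg u hu) (T.pow_dvd_charSum_sub hq' ha hD) hg
  -- The division is exact, since `key` gives `4 λ + 3 = q`.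
  refine ⟨⟨_, _, (Fintype.card F - 3) / 4, rfl, rfl, fun g hg => ?_⟩, ?_, h0, ?_⟩
  · have hset : {p : F × F | p.1 ∈ reeTitsSet (3 ^ (h + 1)) a ∧ p.2 ∈ reeTitsSet (3 ^ (h + 1)) a ∧
        p.1 ≠ p.2 ∧ p.1 - p.2 = g} = ((D ×ˢ D).filter fun p => p.1 - p.2 = g : Finset (F × F)) := by
      ext p
      simp only [Set.mem_ofPred_eq, Finset.coe_filter, Finset.mem_product, hD]
      constructor
      · rintro ⟨h1, h2, -, h3⟩
        exact ⟨⟨h1, h2⟩, h3⟩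
      · rintro ⟨⟨h1, h2⟩, h3⟩
        exact ⟨h1, h2, fun h4 => hg (by rw [← h3, h4, sub_self]), h3⟩
    rw [hset, Set.ncard_coe_finset]
    have := key hg
    omega
  · rw [Set.disjoint_left]
    intro u hu hu'
    have hu0 : u ≠ 0 := fun h1 => h0 (h1 ▸ hu)
    exact (hneg u hu0).1 hu hu'
  · ext u
    simp only [Set.mem_union, Set.mem_neg, Set.mem_singleton_iff, Set.mem_univ, iff_true]
    by_cases hu : u = 0
    · exact Or.inr hu
    · have := hneg u hu
      tauto
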